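/- Setting. Let $\mathcal A_{\mathcal R}$ be a unital C*-algebra with two commuting strongly continuous one-parameter groups of *-automorphisms $\alpha^L_t,\alpha^R_t$ (the left and right reservoir dynamics). Let $n\ge 1$, let $H_{\mathcal S}\in M(n,\mathbb C)$ be self-adjoint, $\alpha^{\mathcal S}_t(A)=e^{itH_{\mathcal S}}Ae^{-itH_{\mathcal S}}$, $\mathcal A=M(n,\mathbb C)\otimes\mathcal A_{\mathcal R}$ and $\alpha_t=\alpha^{\mathcal S}_t\otimes(\alpha^L_t\circ\alpha^R_t)$. Let $\beta_L\ge\beta_R>0$, and let $\omega=\omega_{\mathcal S}\otimes\omega_{\mathcal R}$, where $\omega_{\mathcal S}=\frac1n\mathrm{Tr}$ and $\omega_{\mathcal R}$ is a $(1,\tilde\alpha)$-KMS state on $\mathcal A_{\mathcal R}$ for $\tilde\alpha_t=\alpha^L_{\beta_Lt}\circ\alpha^R_{\beta_Rt}$, i.e. for all $A,B$ there is a function $F$, bounded and continuous on $0\le\mathrm{Im}\,z\le1$ and analytic in the interior, with $F(t)=\omega_{\mathcal R}(A\tilde\alpha_t(B))$ and $F(t+i)=\omega_{\mathcal R}(\tilde\alpha_t(B)A)$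 for $t\in\mathbb R$. Let $V=V^*\in\mathcal A$, and let $\alpha^V_t$ be the perturbed dynamics given by the norm convergent Dyson series $$\alpha_t^V(A)=\alpha_t(A)+\sum_{m\ge1} i^m\int_0^t dt_1\int_0^{t_1}dt_2\cdots\int_0^{t_{m-1}}dt_m\,[\alpha_{t_m}(V),[\cdots,[\alpha_{t_1}(V),\alpha_t(A)]\cdots]].$$ Let $\delta_V$, $\delta_L$, $\delta_R$ be the generators (norm derivatives at $t=0$) of $\alpha^V_t$, $\mathrm{id}\otimes\alpha^L_t$, $\mathrm{id}\otimes\alpha^R_t$ on $\mathcal A$, with their natural domains. Theorem 3.3. Assume (A1) the strong limit $\gamma=\text{s-}\lim_{t\to\infty}\alpha_{-t}\circ\alpha^V_t$ exists; (A2) $\mathrm{Ran}\,\gamma=I\otimes\mathcal A_{\mathcal R}$. Put $\omega_+=\omega\circ\gamma$. Then $\gamma$ is injective, and the following hold. 1. If $\omega$ is $\alpha$-invariant, then $\omega_+$ is a non-equilibrium steady state with initial state $\omega$: there are $T_k\nearrow\infty$ with $\omega_+(A)=\lim_{k\to\infty}\frac1{T_k}\int_0^{T_k}\omega(\alpha^V_t(A))\,dt$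 for all $A\in\mathcal A$. 2. Let $U\in\mathrm{Dom}(\delta_V)$ be unitary with $\gamma(U)\in\mathrm{Dom}(\delta_L)\cap\mathrm{Dom}(\delta_R)$. Then $(\delta_L-\delta_R)(\gamma(U))\in\mathrm{Ran}\,\gamma$, the number $i\omega_+(U^*\delta_V(U))$ is real, and $$i\omega_+(U^*\delta_V(U))\le\frac{\beta_L-\beta_R}{\beta_L+\beta_R}\,\big\|\gamma^{-1}\circ(\delta_L-\delta_R)\circ\gamma(U)\big\|.$$ For fixed $\beta_R$, $\alpha^L$, $\alpha^R$, $V$ and $U$ (which determine the norm on the right), the bound tends to $0$ as $\beta_L\to\beta_R$. 3. If $\beta_L=\beta_R$, then $i\omega_+(U^*\delta_V(U))$ is real and $\le0$ for every unitary $U\in\mathrm{Dom}(\delta_V)$ (the second law). -/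

import Mathlib

open Filter Topology

noncomputable section

namespace NESS

/-! ### C*-dynamics, generators, states, the KMS condition -/

/-- A strongly continuous one-parameter group of *-automorphisms of a C*-algebra. -/
structure CStarDynamics (A : Type*) [CStarAlgebra A] where
  aut : ℝ → (A ≃⋆ₐ[ℂ] A)
  aut_zero : ∀ a : A, aut 0 a = a
  aut_add : ∀ (s t : ℝ) (a : A), aut (s + t) a = aut s (aut t a)
  tendsto_zero : ∀ a : A, Tendsto (fun t : ℝ => ‖aut t a - a‖) (𝓝 0) (𝓝 0)

/-- The automorphism at time `t`, seen as a linear map. -/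
def CStarDynamics.lin {A : Type*} [CStarAlgebra A] (α : CStarDynamics A) (t : ℝ) : A →ₗ[ℂ] A where
  toFun := α.aut t
  map_add' := map_add (α.aut t)
  map_smul' c a := map_smul (α.aut t) c a

/-- The domain of the generator of a family of maps `T t` with `T 0 = id`: those `a` for which
`t ↦ T t a` is norm differentiable at `0`. -/
def genDomain {A : Type*} [CStarAlgebra A] (T : ℝ → A → A) : Set A :=
  {a | DifferentiableAt ℝ (fun t : ℝ => T t a) 0}

/-- The generator `a ↦ d/dt T t a` at `t = 0` (meaningful on `genDomain T`). -/
def gen {A : Type*} [CStarAlgebra A] (T : ℝ → A → A) (a : A) : A :=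
  deriv (fun t : ℝ => T t a) 0

/-- A state: a normalized positive linear functional. -/
def IsState {A : Type*} [CStarAlgebra A] (ω : A →ₗ[ℂ] ℂ) : Prop :=
  (∀ a : A, 0 ≤ (ω (star a * a)).re ∧ (ω (star a * a)).im = 0) ∧ ω 1 = 1

/-- The KMS condition at inverse temperature `β` with respect to the family of maps `τ`. -/
def IsKMS {A : Type*} [CStarAlgebra A] (β : ℝ) (τ : ℝ → A → A) (ω : A →ₗ[ℂ] ℂ) : Prop :=
  ∀ a b : A, ∃ F : ℂ → ℂ,
    DifferentiableOn ℂ F {z : ℂ | 0 < z.im ∧ z.im < β} ∧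
    ContinuousOn F {z : ℂ | 0 ≤ z.im ∧ z.im ≤ β} ∧
    (∃ C : ℝ, ∀ z : ℂ, 0 ≤ z.im → z.im ≤ β → ‖F z‖ ≤ C) ∧
    (∀ t : ℝ, F (t : ℂ) = ω (a * τ t b)) ∧
    (∀ t : ℝ, F ((t : ℂ) + (β : ℂ) * Complex.I) = ω (τ t b * a))

/-! ### The perturbed dynamics and non-equilibrium steady states -/

/-- The iterated integral
`∫_0^s dt₁ ∫_0^{t₁} dt₂ ⋯ ∫_0^{t_{n-1}} dt_n [α_{t_n}(V), [⋯, [α_{t₁}(V), x] ⋯ ]]`. -/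
def dysonTerm {A : Type*} [CStarAlgebra A] (α : ℝ → A → A) (V : A) : ℕ → ℝ → A → A
  | 0, _, x => x
  | n + 1, s, x => ∫ t₁ in (0 : ℝ)..s, dysonTerm α V n t₁ (α t₁ V * x - x * α t₁ V)

/-- The dynamics perturbed by `V`, given by its norm convergent Dyson series. -/
def perturbed {A : Type*} [CStarAlgebra A] (α : ℝ → A → A) (V : A) (t : ℝ) (a : A) : A :=
  ∑' n : ℕ, Complex.I ^ n • dysonTerm α V n t (α t a)

/-- `ω'` is a non-equilibrium steady state of the dynamics `τ` with initial state `ω`: a pointwise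
limit of time averages `(1 / T_k) ∫_0^{T_k} ω ∘ τ_t dt` along an increasing sequence
`T_k → ∞`. -/
def IsNESS {A : Type*} [CStarAlgebra A] (τ : ℝ → A → A) (ω : A → ℂ) (ω' : A → ℂ) : Prop :=
  ∃ T : ℕ → ℝ, StrictMono T ∧ Tendsto T atTop atTop ∧
    ∀ a : A, Tendsto (fun k : ℕ => ((1 / T k : ℝ) : ℂ) * ∫ t in (0 : ℝ)..(T k), ω (τ t a))
      atTop (𝓝 (ω' a))

/-- The work `i ω(U* δ(U))` extracted from `ω` by the unitary `U`, with `δ` the generator of the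
dynamics `τ`. -/
def extractedWork {A : Type*} [CStarAlgebra A] (τ : ℝ → A → A) (ω : A → ℂ) (U : A) : ℂ :=
  Complex.I * ω (star U * gen τ U)

/-! ### The composite of a small system `M(n, ℂ)` with a reservoir

The C*-algebra `M(n, ℂ) ⊗ B` is realized, as usual, as the C*-algebra of `n × n` matrices
over `B`. -/

/-- The observables of the small system. -/
abbrev Small (n : ℕ) : Type := Matrix (Fin n) (Fin n) ℂ

/-- The C*-algebra `M(n, ℂ) ⊗ B`. -/
abbrev Composite (n : ℕ) (B : Type*) : Type _ := CStarMatrix (Fin n) (Fin n) B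

section Tensor

variable {n : ℕ} {B : Type*} [CStarAlgebra B]

/-- The elementary tensor `x ⊗ b`. -/
def tmul (x : Small n) (b : B) : Composite n B :=
  CStarMatrix.ofMatrix (Matrix.of fun i j => x i j • b)

/-- The tensor product `φ ⊗ ψ` of linear maps, written through the matrix units: a matrix `M`
over `B` is `∑ i j, E i j ⊗ M i j`. -/
def tensorMap (φ : Small n →ₗ[ℂ] Small n) (ψ : B →ₗ[ℂ] B) (M : Composite n B) : Composite n B :=
  ∑ i : Fin n, ∑ j : Fin n, tmul (φ (Matrix.single i j 1)) (ψ (M i j))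

/-- The tensor product `φ ⊗ ψ` of linear functionals. -/
def tensorFunctional (φ : Small n →ₗ[ℂ] ℂ) (ψ : B →ₗ[ℂ] ℂ) (M : Composite n B) : ℂ :=
  ∑ i : Fin n, ∑ j : Fin n, φ (Matrix.single i j 1) * ψ (M i j)

theorem tmul_apply (x : Small n) (b : B) (i j : Fin n) : tmul x b i j = x i j • b := rfl

theorem sum_apply {ι : Type*} (s : Finset ι) (f : ι → Composite n B) (k l : Fin n) :
    (∑ i ∈ s, f i) k l = ∑ i ∈ s, f i k l := by
  classical
  induction s using Finset.induction_on with
  | empty => simp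
  | insert a s ha ih => rw [Finset.sum_insert ha, Finset.sum_insert ha, CStarMatrix.add_apply, ih]

theorem tmul_mul_tmul (x y : Small n) (a b : B) :
    tmul x a * tmul y b = tmul (x * y) (a * b) := by
  ext i j
  simp only [CStarMatrix.mul_apply, tmul_apply, Matrix.mul_apply, Finset.sum_smul, smul_mul_smul]

theorem sum_tmul_single (M : Composite n B) :
    ∑ i : Fin n, ∑ j : Fin n, tmul (Matrix.single i j 1) (M i j) = M := by
  ext k l
  simp only [sum_apply, tmul_apply, Matrix.single_apply]
  rw [Finset.sum_eq_single k, Finset.sum_eq_single l] <;> simp +contextual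

theorem tensorMap_tmul (φ : Small n →ₗ[ℂ] Small n) (ψ : B →ₗ[ℂ] B) (x : Small n) (b : B) :
    tensorMap φ ψ (tmul x b) = tmul (φ x) (ψ b) := by
  ext k l
  have hx : φ x = ∑ i : Fin n, ∑ j : Fin n, x i j • φ (Matrix.single i j 1) := by
    conv_lhs => rw [Matrix.matrix_eq_sum_single x]
    simp only [map_sum, ← map_smul, Matrix.smul_single, smul_eq_mul, mul_one]
  simp only [tensorMap, sum_apply, tmul_apply, hx, Matrix.sum_apply, Matrix.smul_apply,
    Finset.sum_smul, map_smul, smul_smul, smul_eq_mul]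
  simp only [mul_comm]

theorem tensorFunctional_tmul (φ : Small n →ₗ[ℂ] ℂ) (ψ : B →ₗ[ℂ] ℂ) (x : Small n) (b : B) :
    tensorFunctional φ ψ (tmul x b) = φ x * ψ b := by
  have hs (i j : Fin n) : Matrix.single i j (x i j) = x i j • Matrix.single i j (1 : ℂ) := by
    rw [Matrix.smul_single, smul_eq_mul, mul_one]
  have hx : φ x = ∑ i : Fin n, ∑ j : Fin n, x i j * φ (Matrix.single i j 1) := by
    conv_lhs => rw [Matrix.matrix_eq_sum_single x]
    simp only [map_sum, hs, map_smul, smul_eq_mul]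
  simp only [tensorFunctional, tmul_apply, hx, Finset.sum_mul, map_smul, smul_eq_mul]
  refine Finset.sum_congr rfl fun i _ => Finset.sum_congr rfl fun j _ => ?_
  ring

/-- The dynamics `x ↦ e^{itH} x e^{-itH}` of the small system. -/
def smallDyn (H : Small n) (t : ℝ) : Small n →ₗ[ℂ] Small n :=
  (LinearMap.mulLeft ℂ (NormedSpace.exp ((Complex.I * (t : ℂ)) • H))).comp
    (LinearMap.mulRight ℂ (NormedSpace.exp (-((Complex.I * (t : ℂ)) • H))))

/-- The chaotic state `x ↦ (1 / n) Tr x` of the small system. -/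
def chaotic (n : ℕ) : Small n →ₗ[ℂ] ℂ :=
  (1 / (n : ℂ)) • Matrix.traceLinearMap (Fin n) ℂ ℂ

/-- The uncoupled dynamics `α_t = α^S_t ⊗ (α^L_t ∘ α^R_t)`. -/
def freeDyn (H : Small n) (αL αR : CStarDynamics B) (t : ℝ) : Composite n B → Composite n B :=
  tensorMap (smallDyn H t) ((αL.lin t).comp (αR.lin t))

/-- A dynamics of the reservoir acting on the composite system as `id ⊗ τ_t`. -/
def ampl (τ : CStarDynamics B) (t : ℝ) : Composite n B → Composite n B :=
  tensorMap LinearMap.id (τ.lin t)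

/-- The initial state `ω_S ⊗ ω_R`, with `ω_S` the chaotic state. -/
def initState (ωR : B →ₗ[ℂ] ℂ) : Composite n B → ℂ :=
  tensorFunctional (chaotic n) ωR

variable [PartialOrder B] [StarOrderedRing B]

/-- The element `(δ_L - δ_R)(a)` of the composite algebra, where `δ_L` and `δ_R` are the generators
of `id ⊗ α^L_t` and `id ⊗ α^R_t`. -/
def diffGen (αL αR : CStarDynamics B) (a : Composite n B) : Composite n B :=
  gen (ampl αL) a - gen (ampl αR) a

end Tensor

end NESS

end

/-!
The scattering morphism `γ` is a strong limit of *-automorphisms, hence an isometric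
*-homomorphism, and it intertwines the perturbed and the uncoupled dynamics. Isometry gives the
injectivity, and invariance of the initial state turns the convergence of `α_{-t} ∘ α^V_t` into
convergence of `ω ∘ α^V_t` itself, so that its time averages converge too
(`NESS.isNESS_scattering`). Since the range of `γ` is `1 ⊗ B`, a unitary `U` in the domain of the
perturbed generator is sent to `1 ⊗ u` with `u` in the domain of the generator `δ` of `α^L ∘ α^R`,
and the work extracted by `U` is `i ω_R(u* δ(u))` (`NESS.exists_extractedWork_eq`).

What remains concerns the reservoirs alone. A KMS state is passive
(`NESS.IsKMS.re_I_mul_nonpos`): the KMS function `F` of `(u*, u)` is bounded by `1` on the strip,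
by Phragmén–Lindelöf, and `F(0) = 1`, so that the derivative of `Re F` at `0` along the imaginary
axis is nonpositive; this derivative is `Re (i ω(u* δ(u)))`, because the KMS function of
`(u*, δ(u))` is the derivative of `F` up to the boundary. The estimate at different temperatures
follows from
`(β_L + β_R)(δ_L + δ_R) = 2 (β_L δ_L + β_R δ_R) - (β_L - β_R)(δ_L - δ_R)`
(`NESS.re_I_mul_le_of_KMS`).

That the Dyson series defines a one-parameter group of *-automorphisms is proved with the
interaction picture propagator `W`, the solution of `W' = W i α_t(V)`, `W(0) = 1`. The Dyson series
is the ordered exponential of `i [α_t(V), ·]` in the Banach algebra of bounded operators, and it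
equals conjugation by the unitary cocycle `W` (`NESS.CStarDynamics.perturbed_eq`).
-/

noncomputable section

namespace NESS

/-! ### States -/

section States

variable {A : Type*} [CStarAlgebra A]

theorem IsState.map_star {ω : A →ₗ[ℂ] ℂ} (hω : IsState ω) (a : A) :
    ω (star a) = star (ω a) := by
  have h1 := (hω.1 (1 + a)).2
  have h2 := (hω.1 (1 + Complex.I • a)).2
  have h3 := (hω.1 a).2
  have e1 : star (1 + a) * (1 + a) = 1 + a + star a + star a * a := by
    rw [star_add, star_one]; noncomm_ring
  have e2 : star (1 + Complex.I • a) * (1 + Complex.I • a)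
      = 1 + Complex.I • a - Complex.I • star a + star a * a := by
    have hI : Complex.I * star Complex.I = 1 := by simp
    simp only [star_add, star_one, star_smul, add_mul, mul_add, one_mul, mul_one,
      smul_mul_smul_comm, mul_comm (star Complex.I), hI, one_smul]
    simp only [RCLike.star_def, Complex.conj_I, neg_smul]
    abel
  rw [e1] at h1
  rw [e2] at h2
  simp only [map_add, map_sub, map_smul, hω.2, smul_eq_mul, Complex.add_im, Complex.sub_im,
    Complex.mul_im, Complex.I_re, Complex.I_im, Complex.one_im] at h1 h2
  apply Complex.ext <;> simp <;> linarith

variable [PartialOrder A] [StarOrderedRing A]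

theorem IsState.re_map_star_mul_self_le {ω : A →ₗ[ℂ] ℂ} (hω : IsState ω) (a : A) :
    (ω (star a * a)).re ≤ ‖a‖ ^ 2 := by
  have h : 0 ≤ algebraMap ℝ A (‖a‖ ^ 2) - star a * a := by
    have := IsSelfAdjoint.le_algebraMap_norm_self (IsSelfAdjoint.star_mul_self a)
    rw [CStarRing.norm_star_mul_self, ← sq] at this
    exact sub_nonneg.2 this
  obtain ⟨b, hb⟩ := CStarAlgebra.nonneg_iff_eq_star_mul_self.1 h
  have := (hω.1 b).1
  rw [← hb, Algebra.algebraMap_eq_smul_one, ← Complex.coe_smul, map_sub, map_smul, hω.2] at this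
  simp only [smul_eq_mul, mul_one, Complex.sub_re, Complex.ofReal_re] at this
  linarith

theorem IsState.norm_apply_le {ω : A →ₗ[ℂ] ℂ} (hω : IsState ω) (a : A) : ‖ω a‖ ≤ ‖a‖ := by
  have h := (hω.1 (a - ω a • 1)).1
  have e : star (a - ω a • (1 : A)) * (a - ω a • 1)
      = star a * a - ω a • star a - star (ω a) • a + (star (ω a) * ω a) • 1 := by
    simp only [star_sub, star_smul, star_one, sub_mul, mul_sub, one_mul,
      smul_mul_assoc, mul_smul_comm, mul_one, smul_sub, smul_smul, mul_comm (star (ω a))]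
    abel
  rw [e] at h
  simp only [map_add, map_sub, map_smul, hω.map_star, hω.2, smul_eq_mul, mul_one] at h
  have h2 := hω.re_map_star_mul_self_le a
  have h3 : ‖ω a‖ ^ 2 ≤ ‖a‖ ^ 2 := by
    rw [Complex.sq_norm, Complex.normSq_apply]
    simp only [RCLike.star_def, Complex.add_re, Complex.sub_re, Complex.mul_re, Complex.conj_re,
      Complex.conj_im] at h
    linarith
  exact le_of_sq_le_sq h3 (norm_nonneg _)

/-- A state as a continuous functional. -/
def IsState.toCLM {ω : A →ₗ[ℂ] ℂ} (hω : IsState ω) : A →L[ℂ] ℂ :=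
  ω.mkContinuous 1 fun a => by simpa using hω.norm_apply_le a

end States

/-! ### One-parameter automorphism groups -/

namespace CStarDynamics

variable {A : Type*} [CStarAlgebra A] (α : CStarDynamics A)

theorem norm_aut (t : ℝ) (a : A) : ‖α.aut t a‖ = ‖a‖ :=
  NonUnitalStarAlgHom.norm_map (α.aut t) (α.aut t).injective a

theorem continuous_aut (a : A) : Continuous fun t => α.aut t a := by
  rw [continuous_iff_continuousAt]
  intro t
  rw [ContinuousAt, tendsto_iff_norm_sub_tendsto_zero]
  have h : Tendsto (fun s : ℝ => s - t) (𝓝 t) (𝓝 0) := by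
    simpa using (continuous_id.sub continuous_const).tendsto (f := fun s : ℝ => s - t) t
  refine ((α.tendsto_zero a).comp h).congr fun s => ?_
  have : α.aut s a = α.aut t (α.aut (s - t) a) := by
    rw [← α.aut_add, add_sub_cancel]
  rw [Function.comp_apply, this, ← map_sub, α.norm_aut]

/-- `δ(u*) u + u* δ(u) = δ(u* u) = 0` for a unitary `u` in the domain of the generator `δ`. -/
theorem star_generator_mul_add {u d : A} (hu : u ∈ unitary A)
    (hd : HasDerivAt (fun t => α.aut t u) d 0) : star d * u + star u * d = 0 := by
  have h := hd.star.mul hd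
  have hc : ((fun t => star (α.aut t u)) * fun t => α.aut t u) = fun _ => (1 : A) := by
    funext t
    rw [Pi.mul_apply, ← map_star, ← map_mul, Unitary.star_mul_self_of_mem hu, map_one]
  rw [hc] at h
  simpa [α.aut_zero] using h.unique (hasDerivAt_const (0 : ℝ) (1 : A))

/-- The composite of two commuting dynamics. -/
def comp (α σ : CStarDynamics A) (h : ∀ (s t : ℝ) (a : A),
    α.aut s (σ.aut t a) = σ.aut t (α.aut s a)) : CStarDynamics A where
  aut t := (σ.aut t).trans (α.aut t)
  aut_zero a := by simp [α.aut_zero, σ.aut_zero]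
  aut_add s t a := by simp [α.aut_add, σ.aut_add, h]
  tendsto_zero a := by
    have h1 := (α.tendsto_zero a).add (σ.tendsto_zero a)
    rw [add_zero] at h1
    refine squeeze_zero (fun _ => norm_nonneg _) (fun t => ?_) h1
    calc ‖(σ.aut t).trans (α.aut t) a - a‖
        = ‖(α.aut t a - a) + α.aut t (σ.aut t a - a)‖ := by
          rw [map_sub, StarAlgEquiv.trans_apply]; congr 1; abel
      _ ≤ ‖α.aut t a - a‖ + ‖σ.aut t a - a‖ := by
          refine (norm_add_le _ _).trans_eq ?_
          rw [α.norm_aut]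

@[simp]
theorem comp_aut (α σ : CStarDynamics A) (h) (t : ℝ) (a : A) :
    (comp α σ h).aut t a = α.aut t (σ.aut t a) := rfl

/-- The dynamics `α` with time rescaled by the factor `c`. -/
def rescale (c : ℝ) : CStarDynamics A where
  aut t := α.aut (c * t)
  aut_zero a := by simp [α.aut_zero]
  aut_add s t a := by rw [mul_add, α.aut_add]
  tendsto_zero a := by
    have h : Tendsto (fun t : ℝ => c * t) (𝓝 0) (𝓝 0) := by
      simpa using (continuous_const.mul continuous_id).tendsto (f := fun t : ℝ => c * t) 0
    exact (α.tendsto_zero a).comp h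

theorem hasDerivAt_rescale {a d : A} (c : ℝ) (h : HasDerivAt (fun t => α.aut t a) d 0) :
    HasDerivAt (fun t => (α.rescale c).aut t a) (c • d) 0 := by
  have h0 : HasDerivAt (fun t : ℝ => c * t) c 0 := by
    simpa using (hasDerivAt_id (0 : ℝ)).const_mul c
  rw [← mul_zero c] at h
  exact h.scomp (0 : ℝ) h0

/-- The generator of a composite of commuting dynamics is the sum of the generators, on the
intersection of their domains. -/
theorem hasDerivAt_comp {α σ : CStarDynamics A} (hc) {a d e : A}
    (hα : HasDerivAt (fun t => α.aut t a) d 0) (hσ : HasDerivAt (fun t => σ.aut t a) e 0) :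
    HasDerivAt (fun t => (comp α σ hc).aut t a) (d + e) 0 := by
  rw [hasDerivAt_iff_tendsto_slope] at hα hσ ⊢
  have h2 : Tendsto (fun t => α.aut t (slope (fun t => σ.aut t a) 0 t)) (𝓝[≠] 0) (𝓝 e) := by
    rw [tendsto_iff_norm_sub_tendsto_zero] at hσ ⊢
    have h3 := hσ.add ((α.tendsto_zero e).mono_left nhdsWithin_le_nhds)
    rw [add_zero] at h3
    refine squeeze_zero (fun _ => norm_nonneg _) (fun t => ?_) h3
    rw [← α.norm_aut t (slope _ _ _ - e), map_sub]
    exact norm_sub_le_norm_sub_add_norm_sub _ _ _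
  refine (hα.add h2).congr fun t => ?_
  simp only [slope_def_module, comp_aut, sub_zero, α.aut_zero, σ.aut_zero]
  rw [← Complex.coe_smul, ← Complex.coe_smul, ← Complex.coe_smul, map_smul, map_sub, ← smul_add]
  congr 1
  abel

end CStarDynamics

/-- The work extracted by a unitary is real, since the generator is a *-derivation. -/
theorem IsState.im_I_mul_eq_zero {A : Type*} [CStarAlgebra A] (α : CStarDynamics A) {ω : A →ₗ[ℂ] ℂ} (hω : IsState ω)
    {u d : A} (hu : u ∈ unitary A) (hd : HasDerivAt (fun t => α.aut t u) d 0) :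
    (Complex.I * ω (star u * d)).im = 0 := by
  have h := α.star_generator_mul_add hu hd
  have h2 := hω.map_star (star u * d)
  rw [star_mul, star_star, eq_neg_of_add_eq_zero_left h, map_neg] at h2
  have := congrArg Complex.re h2
  simp only [Complex.neg_re, RCLike.star_def, Complex.conj_re] at this
  simp only [Complex.mul_im, Complex.I_re, Complex.I_im]
  linarith

/-! ### The second law for KMS states -/

section KMS

open Complex

/-- Phragmén–Lindelöf for bounded functions on a horizontal strip. -/
theorem norm_le_of_norm_le_on_strip_boundary {F : ℂ → ℂ} {β C : ℝ} (hβ : 0 < β)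
    (hd : DifferentiableOn ℂ F {z : ℂ | 0 < z.im ∧ z.im < β})
    (hc : ContinuousOn F {z : ℂ | 0 ≤ z.im ∧ z.im ≤ β})
    (hb : ∃ M : ℝ, ∀ z : ℂ, 0 ≤ z.im → z.im ≤ β → ‖F z‖ ≤ M)
    (h0 : ∀ t : ℝ, ‖F t‖ ≤ C) (h1 : ∀ t : ℝ, ‖F (t + β * I)‖ ≤ C)
    {z : ℂ} (hz0 : 0 ≤ z.im) (hz1 : z.im ≤ β) : ‖F z‖ ≤ C := by
  obtain ⟨M, hM⟩ := hb
  refine PhragmenLindelof.horizontal_strip (f := F) (a := 0) (b := β) ⟨hd, hc.mono ?_⟩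
    ⟨0, by rw [sub_zero]; positivity, 0, ?_⟩ (fun w hw => ?_) (fun w hw => ?_) hz0 hz1
  · refine closure_minimal (fun w hw => ⟨hw.1.le, hw.2.le⟩) ?_
    exact (isClosed_le continuous_const continuous_im).inter
      (isClosed_le continuous_im continuous_const)
  · refine Asymptotics.IsBigO.of_bound M ?_
    refine Filter.Eventually.filter_mono inf_le_right ?_
    refine eventually_principal.2 fun w hw => ?_
    simpa using hM w hw.1.le hw.2.le
  · have : w = (w.re : ℂ) := Complex.ext (by simp) (by simp [hw])
    rw [this]; exact h0 _
  · have : w = (w.re : ℂ) + β * I := Complex.ext (by simp) (by simp [hw])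
    rw [this]; exact h1 _

variable {A : Type*} [CStarAlgebra A] [PartialOrder A] [StarOrderedRing A]

/-- The KMS functions `F` of `(a, b)` and `G` of `(a, δ(b))`, where `δ` is the generator, satisfy
`F' = G` inside the strip: the difference quotients of `F` along the real direction are controlled
on the whole strip by their values on its boundary. -/
theorem hasDerivAt_of_KMS_function (α : CStarDynamics A) {ω : A →ₗ[ℂ] ℂ} (hω : IsState ω)
    {β : ℝ} (hβ : 0 < β) {a b d : A} (hd : HasDerivAt (fun t => α.aut t b) d 0) {F G : ℂ → ℂ}
    (hFd : DifferentiableOn ℂ F {z : ℂ | 0 < z.im ∧ z.im < β})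
    (hFc : ContinuousOn F {z : ℂ | 0 ≤ z.im ∧ z.im ≤ β})
    (hFb : ∃ C : ℝ, ∀ z : ℂ, 0 ≤ z.im → z.im ≤ β → ‖F z‖ ≤ C)
    (hF0 : ∀ t : ℝ, F t = ω (a * α.aut t b))
    (hF1 : ∀ t : ℝ, F (t + β * I) = ω (α.aut t b * a))
    (hGd : DifferentiableOn ℂ G {z : ℂ | 0 < z.im ∧ z.im < β})
    (hGc : ContinuousOn G {z : ℂ | 0 ≤ z.im ∧ z.im ≤ β})
    (hGb : ∃ C : ℝ, ∀ z : ℂ, 0 ≤ z.im → z.im ≤ β → ‖G z‖ ≤ C)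
    (hG0 : ∀ t : ℝ, G t = ω (a * α.aut t d))
    (hG1 : ∀ t : ℝ, G (t + β * I) = ω (α.aut t d * a))
    {z : ℂ} (hz0 : 0 < z.im) (hz1 : z.im < β) : HasDerivAt F (G z) z := by
  have key (h : ℝ) : ‖F (z + h) - F z - h * G z‖ ≤ ‖a‖ * ‖α.aut h b - b - h • d‖ := by
    have hm : ∀ (s : Set ℝ), Set.MapsTo (fun z : ℂ => z + h) {z | z.im ∈ s} {z | z.im ∈ s} := by
      intro s w hw
      simpa using hw
    have haut (t : ℝ) : α.aut (t + h) b - α.aut t b - h • α.aut t d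
        = α.aut t (α.aut h b - b - h • d) := by
      rw [α.aut_add, map_sub, map_sub, ← Complex.coe_smul, ← Complex.coe_smul, map_smul]
    refine norm_le_of_norm_le_on_strip_boundary (F := fun w => F (w + h) - F w - h * G w) hβ
      ?_ ?_ ?_ (fun t => ?_) (fun t => ?_) hz0.le hz1.le
    · exact ((hFd.comp (differentiable_id.add_const _).differentiableOn
        (hm (Set.Ioo 0 β))).sub hFd).sub (hGd.const_mul _)
    · exact ((hFc.comp (continuous_id.add continuous_const).continuousOn
        (hm (Set.Icc 0 β))).sub hFc).sub (continuousOn_const.mul hGc)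
    · obtain ⟨C, hC⟩ := hFb
      obtain ⟨D, hD⟩ := hGb
      refine ⟨C + C + |h| * D, fun w hw0 hw1 => ?_⟩
      refine (norm_sub_le _ _).trans (add_le_add ((norm_sub_le _ _).trans (add_le_add ?_ ?_)) ?_)
      · exact hC _ (by simpa using hw0) (by simpa using hw1)
      · exact hC _ hw0 hw1
      · rw [norm_mul, norm_real, Real.norm_eq_abs]
        exact mul_le_mul_of_nonneg_left (hD _ hw0 hw1) (abs_nonneg _)
    · have e : F (t + h) - F t - h * G t = ω (a * α.aut t (α.aut h b - b - h • d)) := by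
        rw [← ofReal_add, hF0, hF0, hG0, ← haut, mul_sub, mul_sub, map_sub, map_sub,
          ← Complex.coe_smul, mul_smul_comm, map_smul, smul_eq_mul]
      rw [e, ← α.norm_aut t (α.aut h b - b - h • d)]
      exact (hω.norm_apply_le _).trans (norm_mul_le _ _)
    · have e : F (t + β * I + h) - F (t + β * I) - h * G (t + β * I)
          = ω (α.aut t (α.aut h b - b - h • d) * a) := by
        have e' : (t : ℂ) + β * I + h = ((t + h : ℝ) : ℂ) + β * I := by push_cast; ring
        rw [e', hF1, hF1, hG1, ← haut, sub_mul, sub_mul, map_sub, map_sub,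
          ← Complex.coe_smul, smul_mul_assoc, map_smul, smul_eq_mul]
      rw [e, ← α.norm_aut t (α.aut h b - b - h • d), mul_comm ‖a‖]
      exact (hω.norm_apply_le _).trans (norm_mul_le _ _)
  have hopen : IsOpen {z : ℂ | 0 < z.im ∧ z.im < β} :=
    (isOpen_lt continuous_const continuous_im).inter (isOpen_lt continuous_im continuous_const)
  have hF := (hFd.differentiableAt (hopen.mem_nhds ⟨hz0, hz1⟩)).hasDerivAt
  -- the derivative of `F` at `z` along the real direction
  have hreal : HasDerivAt (fun h : ℝ => F (z + h)) (deriv F z) 0 := by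
    have h1 : HasDerivAt (fun h : ℝ => z + (h : ℂ)) 1 0 := by
      simpa using (Complex.ofRealCLM.hasDerivAt (x := (0 : ℝ))).const_add z
    have h2 : HasDerivAt F (deriv F z) (z + ((0 : ℝ) : ℂ)) := by simpa using hF
    simpa [Function.comp_def] using h2.comp (0 : ℝ) h1
  have hreal' : HasDerivAt (fun h : ℝ => F (z + h)) (G z) 0 := by
    rw [hasDerivAt_iff_isLittleO] at hd ⊢
    refine Asymptotics.IsBigO.trans_isLittleO (Asymptotics.IsBigO.of_bound ‖a‖ ?_) hd
    refine Eventually.of_forall fun h => ?_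
    simpa [α.aut_zero] using key h
  rwa [hreal.unique hreal'] at hF

/-- Passivity of KMS states for unitaries in the domain of the generator. The KMS function `F` of
the pair `(u*, u)` is bounded by `1` on the strip and equals `1` at `0`, so `Re F` cannot increase
along the imaginary axis; its derivative there is `i ω(u* δ(u))`. -/
theorem IsKMS.re_I_mul_nonpos (α : CStarDynamics A) {ω : A →ₗ[ℂ] ℂ} (hω : IsState ω)
    {β : ℝ} (hβ : 0 < β) (hK : IsKMS β (fun t a => α.aut t a) ω) {u d : A} (hu : u ∈ unitary A)
    (hd : HasDerivAt (fun t => α.aut t u) d 0) : (I * ω (star u * d)).re ≤ 0 := by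
  obtain ⟨F, hFd, hFc, hFb, hF0, hF1⟩ := hK (star u) u
  obtain ⟨G, hGd, hGc, hGb, hG0, hG1⟩ := hK (star u) d
  beta_reduce at hF0 hF1 hG0 hG1
  have hone : ‖(1 : A)‖ ≤ 1 := by
    have := CStarRing.norm_star_mul_self (x := (1 : A))
    rw [star_one, mul_one] at this
    nlinarith [sq_nonneg (‖(1 : A)‖ - 1)]
  have hnorm : ‖u‖ ≤ 1 := by
    have := CStarRing.norm_star_mul_self (x := u)
    rw [Unitary.star_mul_self_of_mem hu] at this
    nlinarith [norm_nonneg u]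
  have hF_le {z : ℂ} (h0 : 0 ≤ z.im) (h1 : z.im ≤ β) : ‖F z‖ ≤ 1 := by
    refine norm_le_of_norm_le_on_strip_boundary hβ hFd hFc hFb (fun t => ?_) (fun t => ?_) h0 h1
    · rw [hF0]
      refine (hω.norm_apply_le _).trans ((norm_mul_le _ _).trans ?_)
      rw [norm_star, α.norm_aut]
      exact mul_le_one₀ hnorm (norm_nonneg _) hnorm
    · rw [hF1]
      refine (hω.norm_apply_le _).trans ((norm_mul_le _ _).trans ?_)
      rw [norm_star, α.norm_aut]
      exact mul_le_one₀ hnorm (norm_nonneg _) hnorm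
  have hF00 : F 0 = 1 := by
    have := hF0 0
    rwa [α.aut_zero, Unitary.star_mul_self_of_mem hu, hω.2, ofReal_zero] at this
  have hG00 : G 0 = ω (star u * d) := by
    have := hG0 0
    rwa [α.aut_zero, ofReal_zero] at this
  have hderiv {s : ℝ} (hs : s ∈ Set.Ioo 0 β) :
      HasDerivAt (fun s : ℝ => F (s * I)) (I * G (s * I)) s := by
    have h1 : HasDerivAt (fun s : ℝ => (s : ℂ) * I) I s := by
      simpa using (Complex.ofRealCLM.hasDerivAt (x := s)).mul_const I
    have h2 := hasDerivAt_of_KMS_function α hω hβ hd hFd hFc hFb hF0 hF1 hGd hGc hGb hG0 hG1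
      (z := s * I) (by simpa using hs.1) (by simpa using hs.2)
    simpa [mul_comm, Function.comp_def] using h2.comp s h1
  have hmem : Set.Ioo 0 β ∈ 𝓝[>] (0 : ℝ) := Ioo_mem_nhdsGT hβ
  have hmaps : Set.MapsTo (fun s : ℝ => (s : ℂ) * I) (Set.Icc 0 β)
      {z : ℂ | 0 ≤ z.im ∧ z.im ≤ β} := fun s hs => by simpa using hs
  have hcont : ContinuousOn (fun s : ℝ => (s : ℂ) * I) (Set.Icc 0 β) := by fun_prop
  have hright : HasDerivWithinAt (fun s : ℝ => F (s * I)) (I * G 0) (Set.Ici 0) 0 := by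
    refine hasDerivWithinAt_Ici_of_tendsto_deriv (s := Set.Ioo 0 β)
      (fun s hs => (hderiv hs).differentiableAt.differentiableWithinAt) ?_ hmem ?_
    · exact ((hFc.comp hcont hmaps) 0 ⟨le_rfl, hβ.le⟩).mono Set.Ioo_subset_Icc_self
    · have h1 : ContinuousWithinAt (fun s : ℝ => I * G (s * I)) (Set.Ioo 0 β) 0 :=
        ((continuousOn_const.mul (hGc.comp hcont hmaps)) 0 ⟨le_rfl, hβ.le⟩).mono
          Set.Ioo_subset_Icc_self
      have h2 := h1.tendsto
      rw [nhdsWithin_Ioo_eq_nhdsGT hβ] at h2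
      simp only [ofReal_zero, zero_mul] at h2
      refine h2.congr' ?_
      filter_upwards [hmem] with s hs using (hderiv hs).deriv.symm
  rw [hG00] at hright
  have hslope := (hasDerivWithinAt_iff_tendsto_slope.1 hright)
  rw [Set.Ici_sdiff_left] at hslope
  refine le_of_tendsto ((continuous_re.tendsto _).comp hslope) ?_
  filter_upwards [hmem] with s hs
  have h1 : (F (s * I)).re ≤ 1 :=
    (re_le_norm _).trans (hF_le (by simpa using hs.1.le) (by simpa using hs.2.le))
  simp only [Function.comp_apply, slope_def_module, sub_zero, ofReal_zero, zero_mul, hF00,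
    smul_re, sub_re, one_re, smul_eq_mul]
  exact mul_nonpos_of_nonneg_of_nonpos (inv_nonneg.2 hs.1.le) (by linarith)

end KMS

/-! ### Ordered exponentials -/

section OrderedExp

variable {R : Type*} [NormedRing R] [NormedAlgebra ℂ R]

/-- The terms of the ordered exponential `∑ ∫_0^t dt₁ ∫_0^{t₁} dt₂ ⋯ K(t_m) ⋯ K(t₂) K(t₁)`. -/
def orderedExpTerm (K : ℝ → R) : ℕ → ℝ → R
  | 0, _ => 1
  | m + 1, t => ∫ s in (0 : ℝ)..t, orderedExpTerm K m s * K s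

/-- The ordered exponential of `K`: the solution of `W' = W K`, `W(0) = 1`. -/
def orderedExp (K : ℝ → R) (t : ℝ) : R := ∑' m, orderedExpTerm K m t

theorem orderedExp_zero (K : ℝ → R) : orderedExp K 0 = 1 := by
  rw [orderedExp, tsum_eq_single 0]
  · rfl
  · rintro (_ | m) hm
    · exact absurd rfl hm
    · simp [orderedExpTerm]

theorem continuous_orderedExpTerm {K : ℝ → R} (hK : Continuous K) (m : ℕ) :
    Continuous (orderedExpTerm K m) := by
  induction m with
  | zero => exact continuous_const
  | succ m ih =>
    exact intervalIntegral.continuous_primitive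
      (fun a b => (ih.mul hK).intervalIntegrable a b) 0

theorem norm_orderedExpTerm_le {K : ℝ → R} (hK : Continuous K) {c : ℝ} (hc : ∀ t, ‖K t‖ ≤ c)
    (m : ℕ) (t : ℝ) : ‖orderedExpTerm K m t‖ ≤ ‖(1 : R)‖ * ((c * |t|) ^ m / m.factorial) := by
  induction m generalizing t with
  | zero => simp [orderedExpTerm]
  | succ m ih =>
    have hc0 : 0 ≤ c := (norm_nonneg _).trans (hc 0)
    have hcont := (continuous_orderedExpTerm hK m).mul hK
    calc ‖orderedExpTerm K (m + 1) t‖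
        ≤ ∫ s in Set.uIoc 0 t, ‖orderedExpTerm K m s * K s‖ :=
          intervalIntegral.norm_integral_le_integral_norm_uIoc
      _ ≤ ∫ s in Set.uIoc 0 t, ‖(1 : R)‖ * (c ^ m / m.factorial) * c * |s - 0| ^ m := by
          refine MeasureTheory.setIntegral_mono
            (hcont.norm.integrableOn_uIoc) (Continuous.integrableOn_uIoc (by fun_prop))
            fun s => ?_
          calc ‖orderedExpTerm K m s * K s‖ ≤ ‖orderedExpTerm K m s‖ * ‖K s‖ := norm_mul_le _ _
            _ ≤ ‖(1 : R)‖ * ((c * |s|) ^ m / m.factorial) * c :=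
              mul_le_mul (ih s) (hc s) (norm_nonneg _) (by positivity)
            _ = _ := by rw [mul_pow, sub_zero]; ring
      _ = ‖(1 : R)‖ * ((c * |t|) ^ (m + 1) / (m + 1).factorial) := by
          rw [MeasureTheory.integral_const_mul, integral_pow_abs_sub_uIoc, sub_zero,
            Nat.factorial_succ]
          push_cast
          field_simp
          ring

variable [CompleteSpace R]

theorem summable_orderedExpTerm {K : ℝ → R} (hK : Continuous K) {c : ℝ} (hc : ∀ t, ‖K t‖ ≤ c)
    (t : ℝ) : Summable fun m => orderedExpTerm K m t :=
  Summable.of_norm_bounded ((Real.summable_pow_div_factorial _).mul_left _)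
    fun m => norm_orderedExpTerm_le hK hc m t

theorem hasDerivAt_orderedExp {K : ℝ → R} (hK : Continuous K) {c : ℝ} (hc : ∀ t, ‖K t‖ ≤ c)
    (t : ℝ) : HasDerivAt (orderedExp K) (orderedExp K t * K t) t := by
  have hc0 : 0 ≤ c := (norm_nonneg _).trans (hc 0)
  -- the derivative of the `m`-th term is the `(m - 1)`-st term times `K`
  let g' : ℕ → ℝ → R := fun m s => Nat.casesOn m 0 fun m => orderedExpTerm K m s * K s
  let v : ℕ → ℝ := fun m =>
    Nat.casesOn m 0 fun m => ‖(1 : R)‖ * ((c * (|t| + 1)) ^ m / m.factorial) * c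
  have hv : Summable v := by
    rw [← summable_nat_add_iff 1]
    exact ((Real.summable_pow_div_factorial _).mul_left _).mul_right _
  have hg (m : ℕ) (s : ℝ) : HasDerivAt (orderedExpTerm K m) (g' m s) s := by
    cases m with
    | zero => exact hasDerivAt_const s 1
    | succ m =>
      have hcont := (continuous_orderedExpTerm hK m).mul hK
      exact intervalIntegral.integral_hasDerivAt_right (hcont.intervalIntegrable _ _)
        hcont.stronglyMeasurable.stronglyMeasurableAtFilter hcont.continuousAt
  have hg' (m : ℕ) (s : ℝ) (hs : s ∈ Metric.ball (0 : ℝ) (|t| + 1)) : ‖g' m s‖ ≤ v m := by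
    cases m with
    | zero => simp [g', v]
    | succ m =>
      have hs' : |s| ≤ |t| + 1 := by simpa using (Metric.mem_ball.1 hs).le
      calc ‖g' (m + 1) s‖ ≤ ‖orderedExpTerm K m s‖ * ‖K s‖ := norm_mul_le _ _
        _ ≤ ‖(1 : R)‖ * ((c * |s|) ^ m / m.factorial) * c :=
          mul_le_mul (norm_orderedExpTerm_le hK hc m s) (hc s) (norm_nonneg _) (by positivity)
        _ ≤ v (m + 1) := by
          change _ ≤ ‖(1 : R)‖ * ((c * (|t| + 1)) ^ m / m.factorial) * c
          gcongr
  have ht : t ∈ Metric.ball (0 : ℝ) (|t| + 1) := by simp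
  have key := hasDerivAt_tsum_of_isPreconnected hv Metric.isOpen_ball
    (convex_ball (0 : ℝ) _).isPreconnected (fun m s _ => hg m s) hg' ht
    (summable_orderedExpTerm hK hc t) ht
  have hsum : ∑' m, g' m t = orderedExp K t * K t := by
    have hs : Summable fun m => g' m t := Summable.of_norm_bounded hv fun m => hg' m t ht
    rw [hs.tsum_eq_zero_add]
    exact (zero_add _).trans ((summable_orderedExpTerm hK hc t).tsum_mul_right (K t))
  rwa [hsum] at key

end OrderedExp

/-! ### The perturbed dynamics -/

section Unitary

variable {A : Type*} [CStarAlgebra A]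

/-- The ordered exponential of a skew-adjoint function is unitary. That `W W* = 1` is immediate by
differentiation; `W* W` solves a linear differential equation which is also solved by `1`. -/
theorem orderedExp_mem_unitary {K : ℝ → A} (hK : Continuous K) {c : ℝ} (hc : ∀ t, ‖K t‖ ≤ c)
    (hskew : ∀ t, star (K t) = -K t) (t : ℝ) : orderedExp K t ∈ unitary A := by
  have hW := hasDerivAt_orderedExp hK hc
  have hWs (t : ℝ) : HasDerivAt (fun t => star (orderedExp K t))
      (-K t * star (orderedExp K t)) t := by
    have := (hW t).star
    rwa [star_mul, hskew] at this
  rw [Unitary.mem_iff]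
  constructor
  · have hc0 : 0 ≤ c := (norm_nonneg _).trans (hc 0)
    let v : ℝ → A → A := fun t X => X * K t - K t * X
    have hv (t : ℝ) : LipschitzOnWith ⟨2 * c, by positivity⟩ (v t) Set.univ := by
      refine LipschitzOnWith.of_dist_le_mul fun X _ Y _ => ?_
      have e : v t X - v t Y = (X - Y) * K t - K t * (X - Y) := by
        simp only [v]; noncomm_ring
      rw [dist_eq_norm, dist_eq_norm, e]
      calc ‖(X - Y) * K t - K t * (X - Y)‖ ≤ ‖X - Y‖ * ‖K t‖ + ‖K t‖ * ‖X - Y‖ :=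
            (norm_sub_le _ _).trans (add_le_add (norm_mul_le _ _) (norm_mul_le _ _))
        _ ≤ ‖X - Y‖ * c + c * ‖X - Y‖ := by gcongr <;> exact hc t
        _ = 2 * c * ‖X - Y‖ := by ring
    have h := ODE_solution_unique_univ (t₀ := 0) (s := fun _ => Set.univ) hv
      (f := fun t => star (orderedExp K t) * orderedExp K t) (g := fun _ => 1)
      (fun t => ⟨by
        refine ((hWs t).mul (hW t)).congr_deriv ?_
        simp only [v, mul_assoc, neg_mul]
        abel, trivial⟩)
      (fun t => ⟨(hasDerivAt_const t (1 : A)).congr_deriv (by simp [v]), trivial⟩)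
      (by simp [orderedExp_zero])
    exact congrFun h t
  · have h (s : ℝ) : HasDerivAt (fun t => orderedExp K t * star (orderedExp K t)) 0 s := by
      refine ((hW s).mul (hWs s)).congr_deriv ?_
      noncomm_ring
    have h2 := is_const_of_deriv_eq_zero (fun s => (h s).differentiableAt)
      (fun s => (h s).deriv) t 0
    simpa [orderedExp_zero] using h2

end Unitary

namespace CStarDynamics

variable {A : Type*} [CStarAlgebra A] (α : CStarDynamics A)

theorem cocycle_zero {W : ℝ → A} (hU : ∀ t, W t ∈ unitary A)
    (hadd : ∀ s t, W (s + t) = W s * α.aut s (W t)) : W 0 = 1 := by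
  have h : W 0 = W 0 * W 0 := by simpa [α.aut_zero] using hadd 0 0
  calc W 0 = star (W 0) * W 0 * W 0 := by rw [Unitary.star_mul_self_of_mem (hU 0), one_mul]
    _ = 1 := by rw [mul_assoc, ← h, Unitary.star_mul_self_of_mem (hU 0)]

/-- The dynamics `a ↦ W_t α_t(a) W_t*` defined by a unitary cocycle `W` of `α`. -/
def cocycleConj (W : ℝ → A) (hU : ∀ t, W t ∈ unitary A) (hW : ContinuousAt W 0)
    (hadd : ∀ s t, W (s + t) = W s * α.aut s (W t)) : CStarDynamics A where
  aut t := (α.aut t).trans (Unitary.conjStarAlgAut ℂ A ⟨W t, hU t⟩)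
  aut_zero a := by
    simp [α.cocycle_zero hU hadd, α.aut_zero]
  aut_add s t a := by
    change W (s + t) * α.aut (s + t) a * star (W (s + t))
      = W s * α.aut s (W t * α.aut t a * star (W t)) * star (W s)
    simp only [hadd, α.aut_add, map_mul, map_star, star_mul, mul_assoc]
  tendsto_zero a := by
    rw [← tendsto_iff_norm_sub_tendsto_zero]
    have h : ContinuousAt (fun t => W t * α.aut t a * star (W t)) 0 :=
      (hW.mul (α.continuous_aut a).continuousAt).mul hW.star
    simpa [ContinuousAt, α.cocycle_zero hU hadd, α.aut_zero] using h

/-- The generator `t ↦ i α_t(V)` of the interaction picture propagator. -/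
def interaction (V : A) (t : ℝ) : A := Complex.I • α.aut t V

theorem continuous_interaction (V : A) : Continuous (α.interaction V) :=
  (α.continuous_aut V).const_smul _

theorem norm_interaction_le (V : A) (t : ℝ) : ‖α.interaction V t‖ ≤ ‖V‖ := by
  simp [interaction, norm_smul, α.norm_aut]

theorem star_interaction {V : A} (hV : IsSelfAdjoint V) (t : ℝ) :
    star (α.interaction V t) = -α.interaction V t := by
  rw [interaction, star_smul, ← map_star, hV.star_eq]
  simp

/-- The interaction picture propagator: the solution of `W' = W i α_t(V)`, `W(0) = 1`. -/
def propagator (V : A) : ℝ → A := orderedExp (α.interaction V)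

theorem hasDerivAt_propagator (V : A) (t : ℝ) :
    HasDerivAt (α.propagator V) (α.propagator V t * α.interaction V t) t :=
  hasDerivAt_orderedExp (α.continuous_interaction V) (α.norm_interaction_le V) t

theorem propagator_mem_unitary {V : A} (hV : IsSelfAdjoint V) (t : ℝ) :
    α.propagator V t ∈ unitary A :=
  orderedExp_mem_unitary (α.continuous_interaction V) (α.norm_interaction_le V)
    (α.star_interaction hV) t

theorem hasDerivAt_star_propagator {V : A} (hV : IsSelfAdjoint V) (t : ℝ) :
    HasDerivAt (fun t => star (α.propagator V t))
      (-α.interaction V t * star (α.propagator V t)) t := by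
  have := (α.hasDerivAt_propagator V t).star
  rwa [star_mul, α.star_interaction hV] at this

/-- An automorphism as a continuous linear map over the reals. -/
def autCLM (s : ℝ) : A →L[ℝ] A :=
  ((α.lin s).mkContinuous 1 fun a => by
    rw [one_mul]; exact (α.norm_aut s a).le : A →L[ℂ] A).restrictScalars ℝ

theorem propagator_add {V : A} (hV : IsSelfAdjoint V) (s t : ℝ) :
    α.propagator V (s + t) = α.propagator V s * α.aut s (α.propagator V t) := by
  -- the derivative in `t` of `W_s α_s(W_t) W_{s+t}*` vanishes
  have h (r : ℝ) : HasDerivAt (fun r => α.propagator V s * α.aut s (α.propagator V r)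
      * star (α.propagator V (s + r))) 0 r := by
    have h1 : HasDerivAt (fun r => α.aut s (α.propagator V r))
        (α.aut s (α.propagator V r * α.interaction V r)) r :=
      (α.autCLM s).hasFDerivAt.comp_hasDerivAt r (α.hasDerivAt_propagator V r)
    have h2 := (α.hasDerivAt_star_propagator hV (s + r)).comp_const_add s r
    have h3 : α.aut s (α.interaction V r) = α.interaction V (s + r) := by
      rw [interaction, interaction, map_smul, α.aut_add]
    refine ((h1.const_mul (α.propagator V s)).mul h2).congr_deriv ?_
    rw [map_mul, h3]
    noncomm_ring
  have h2 := is_const_of_deriv_eq_zero (fun s => (h s).differentiableAt)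
    (fun s => (h s).deriv) t 0
  have h0 : α.propagator V 0 = 1 := orderedExp_zero _
  simp only [h0, map_one, mul_one, add_zero,
    Unitary.mul_star_self_of_mem (α.propagator_mem_unitary hV s)] at h2
  calc α.propagator V (s + t) = 1 * α.propagator V (s + t) := (one_mul _).symm
    _ = _ := by
      rw [← h2, mul_assoc, Unitary.star_mul_self_of_mem (α.propagator_mem_unitary hV _), mul_one]

/-- The dynamics `a ↦ W_t α_t(a) W_t*`, with `W` the interaction picture propagator of `V`. -/
def perturb (V : A) (hV : IsSelfAdjoint V) : CStarDynamics A :=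
  α.cocycleConj (α.propagator V) (α.propagator_mem_unitary hV)
    (α.hasDerivAt_propagator V 0).continuousAt (α.propagator_add hV)

/-- The operator `x ↦ i [α_t(V), x]`, whose ordered exponential is the Dyson series. -/
def interactionAd (V : A) (t : ℝ) : A →L[ℂ] A :=
  ContinuousLinearMap.mul ℂ A (α.interaction V t)
    - (ContinuousLinearMap.mul ℂ A).flip (α.interaction V t)

theorem interactionAd_apply (V : A) (t : ℝ) (x : A) :
    α.interactionAd V t x = α.interaction V t * x - x * α.interaction V t := rfl

theorem continuous_interactionAd (V : A) : Continuous (α.interactionAd V) :=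
  ((ContinuousLinearMap.mul ℂ A).continuous.comp (α.continuous_interaction V)).sub
    ((ContinuousLinearMap.mul ℂ A).flip.continuous.comp (α.continuous_interaction V))

theorem norm_interactionAd_le (V : A) (t : ℝ) : ‖α.interactionAd V t‖ ≤ 2 * ‖V‖ := by
  refine ContinuousLinearMap.opNorm_le_bound _ (by positivity) fun x => ?_
  rw [interactionAd_apply]
  calc ‖α.interaction V t * x - x * α.interaction V t‖
      ≤ ‖α.interaction V t‖ * ‖x‖ + ‖x‖ * ‖α.interaction V t‖ :=
        (norm_sub_le _ _).trans (add_le_add (norm_mul_le _ _) (norm_mul_le _ _))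
    _ ≤ ‖V‖ * ‖x‖ + ‖x‖ * ‖V‖ := by gcongr <;> exact α.norm_interaction_le V t
    _ = 2 * ‖V‖ * ‖x‖ := by ring

theorem orderedExpTerm_interactionAd_apply (V : A) (m : ℕ) (t : ℝ) (x : A) :
    orderedExpTerm (α.interactionAd V) m t x
      = Complex.I ^ m • dysonTerm (fun t a => α.aut t a) V m t x := by
  induction m generalizing t x with
  | zero => simp [orderedExpTerm, dysonTerm]
  | succ m ih =>
    have hcont : Continuous fun s =>
        orderedExpTerm (α.interactionAd V) m s * α.interactionAd V s :=
      (continuous_orderedExpTerm (α.continuous_interactionAd V) m).mul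
        (α.continuous_interactionAd V)
    rw [orderedExpTerm, dysonTerm,
      ContinuousLinearMap.intervalIntegral_apply (hcont.intervalIntegrable 0 t),
      ← intervalIntegral.integral_smul]
    refine intervalIntegral.integral_congr fun s _ => ?_
    have e : α.interactionAd V s x = Complex.I • (α.aut s V * x - x * α.aut s V) := by
      rw [interactionAd_apply, interaction, smul_mul_assoc, mul_smul_comm, smul_sub]
    change orderedExpTerm (α.interactionAd V) m s (α.interactionAd V s x) = _
    rw [e, map_smul, ih, smul_smul, pow_succ']

/-- The Dyson series sums up to the conjugation by the propagator `W`: if `Γ` is the ordered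
exponential of `i [α_t(V), ·]`, then `Γ_t(W_t* x W_t)` does not depend on `t`. -/
theorem orderedExp_interactionAd_apply {V : A} (hV : IsSelfAdjoint V) (t : ℝ) (x : A) :
    orderedExp (α.interactionAd V) t x = α.propagator V t * x * star (α.propagator V t) := by
  have hΓ := hasDerivAt_orderedExp (α.continuous_interactionAd V) (α.norm_interactionAd_le V)
  have key (y : A) : orderedExp (α.interactionAd V) t
      (star (α.propagator V t) * y * α.propagator V t) = y := by
    have h (r : ℝ) : HasDerivAt (fun r => orderedExp (α.interactionAd V) r
        (star (α.propagator V r) * y * α.propagator V r)) 0 r := by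
      have h1 := ((α.hasDerivAt_star_propagator hV r).mul_const y).mul
        (α.hasDerivAt_propagator V r)
      have h2 : HasDerivAt (fun r => (orderedExp (α.interactionAd V) r).restrictScalars ℝ)
          ((orderedExp (α.interactionAd V) r * α.interactionAd V r).restrictScalars ℝ) r :=
        (ContinuousLinearMap.restrictScalarsL ℂ A A ℝ ℝ).hasFDerivAt.comp_hasDerivAt r (hΓ r)
      refine (h2.clm_apply h1).congr_deriv ?_
      change orderedExp (α.interactionAd V) r (α.interactionAd V r _)
        + orderedExp (α.interactionAd V) r _ = 0
      rw [← map_add, interactionAd_apply]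
      refine (congrArg _ ?_).trans (map_zero (orderedExp (α.interactionAd V) r))
      simp only [Pi.mul_apply]
      noncomm_ring
    have h2 := is_const_of_deriv_eq_zero (fun s => (h s).differentiableAt)
      (fun s => (h s).deriv) t 0
    have h0 : α.propagator V 0 = 1 := orderedExp_zero _
    simpa [h0, orderedExp_zero] using h2
  have hU := Unitary.star_mul_self_of_mem (α.propagator_mem_unitary hV t)
  rw [← key (α.propagator V t * x * star (α.propagator V t))]
  congr 1
  calc x = (star (α.propagator V t) * α.propagator V t) * x
        * (star (α.propagator V t) * α.propagator V t) := by rw [hU, one_mul, mul_one]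
    _ = _ := by noncomm_ring

/-- The dynamics defined by the Dyson series is the conjugation of the free dynamics by the
interaction picture propagator. -/
theorem perturbed_eq (V : A) (hV : IsSelfAdjoint V) (t : ℝ) (a : A) :
    perturbed (fun t a => α.aut t a) V t a = (α.perturb V hV).aut t a := by
  have hs := summable_orderedExpTerm (α.continuous_interactionAd V) (α.norm_interactionAd_le V) t
  have h := (hs.hasSum.mapL (ContinuousLinearMap.apply ℂ A (α.aut t a))).tsum_eq
  simp only [ContinuousLinearMap.apply_apply, orderedExpTerm_interactionAd_apply] at h
  exact h.trans (α.orderedExp_interactionAd_apply hV t _)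

end CStarDynamics

/-! ### Dynamics of the composite system -/

section Composite

variable {n : ℕ} {B : Type*} [CStarAlgebra B]

theorem star_tmul (x : Small n) (b : B) : star (tmul x b) = tmul (star x) (star b) := by
  ext i j
  simp [CStarMatrix.star_apply, tmul_apply, Matrix.star_apply]

theorem tmul_one_one : tmul (1 : Small n) (1 : B) = 1 := by
  ext i j
  simp only [tmul_apply, Matrix.one_apply, CStarMatrix.one_apply]
  split_ifs <;> simp

/-- The embedding `b ↦ 1 ⊗ b` of the reservoir in the composite system. -/
def reservoirHom (n : ℕ) (B : Type*) [CStarAlgebra B] : B →⋆ₐ[ℂ] Composite n B where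
  toFun b := tmul 1 b
  map_one' := tmul_one_one
  map_mul' a b := by rw [tmul_mul_tmul, one_mul]
  map_zero' := by ext; simp [tmul_apply]
  map_add' a b := by ext; simp [tmul_apply]
  commutes' c := by
    rw [Algebra.algebraMap_eq_smul_one, Algebra.algebraMap_eq_smul_one, ← tmul_one_one]
    ext i j
    simp [tmul_apply, smul_comm c]
  map_star' b := by rw [star_tmul, star_one]

@[simp]
theorem reservoirHom_apply (b : B) : reservoirHom n B b = tmul 1 b := rfl

theorem reservoirHom_injective (hn : 0 < n) : Function.Injective (reservoirHom n B) := by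
  intro a b h
  have : tmul (1 : Small n) a ⟨0, hn⟩ ⟨0, hn⟩ = tmul (1 : Small n) b ⟨0, hn⟩ ⟨0, hn⟩ := by
    rw [← reservoirHom_apply, ← reservoirHom_apply, h]
  simpa [tmul_apply] using this

/-- The *-automorphism `id ⊗ f`, which applies `f` to each entry. -/
def mapAut (f : B ≃⋆ₐ[ℂ] B) : Composite n B ≃⋆ₐ[ℂ] Composite n B where
  toFun M := M.map f
  invFun M := M.map f.symm
  left_inv M := by ext; simp
  right_inv M := by ext; simp
  map_mul' M N := by ext; simp [CStarMatrix.mul_apply]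
  map_add' M N := by ext; simp
  map_star' M := by ext; simp [CStarMatrix.star_apply, map_star]
  map_smul' c M := by ext; simp

@[simp]
theorem mapAut_apply (f : B ≃⋆ₐ[ℂ] B) (M : Composite n B) (i j : Fin n) :
    mapAut f M i j = f (M i j) := rfl

theorem mapAut_tmul (f : B ≃⋆ₐ[ℂ] B) (x : Small n) (b : B) :
    mapAut f (tmul x b) = tmul x (f b) := by
  ext; simp [tmul_apply]

theorem initState_tmul_one (hn : 0 < n) (ω : B →ₗ[ℂ] ℂ) (b : B) :
    initState ω (tmul (1 : Small n) b) = ω b := by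
  have : (n : ℂ) ≠ 0 := by exact_mod_cast hn.ne'
  simp [initState, tensorFunctional_tmul, chaotic, this]

theorem continuous_entry (i j : Fin n) : Continuous fun M : Composite n B => M i j :=
  continuous_apply_apply (ρ := fun _ _ => B) i j

theorem continuous_tmul_const {X : Type*} [TopologicalSpace X] {f : X → Small n}
    (hf : Continuous f) (b : B) : Continuous fun x => (tmul (f x) b : Composite n B) :=
  continuous_pi fun i => continuous_pi fun j =>
    ((continuous_apply_apply i j).comp hf).smul continuous_const

theorem ampl_tmul_one (τ : CStarDynamics B) (t : ℝ) (b : B) :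
    ampl τ t (tmul (1 : Small n) b) = tmul 1 (τ.aut t b) := tensorMap_tmul _ _ _ _

/-- The unitary `e^{itH} ⊗ 1`. -/
def smallPropagator (B : Type*) [CStarAlgebra B] (H : Small n) (t : ℝ) : Composite n B :=
  tmul (NormedSpace.exp ((Complex.I * (t : ℂ)) • H)) 1

theorem star_exp_I_smul {H : Small n} (hH : H.IsHermitian) (t : ℝ) :
    star (NormedSpace.exp ((Complex.I * (t : ℂ)) • H))
      = NormedSpace.exp (-((Complex.I * (t : ℂ)) • H)) := by
  rw [Matrix.star_eq_conjTranspose, ← Matrix.exp_conjTranspose, Matrix.conjTranspose_smul, hH.eq]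
  simp

theorem exp_I_smul_add (H : Small n) (s t : ℝ) :
    NormedSpace.exp ((Complex.I * ((s + t : ℝ) : ℂ)) • H)
      = NormedSpace.exp ((Complex.I * (s : ℂ)) • H)
        * NormedSpace.exp ((Complex.I * (t : ℂ)) • H) := by
  rw [← Matrix.exp_add_of_commute _ _ (((Commute.refl H).smul_left _).smul_right _), ← add_smul]
  push_cast
  rw [mul_add]

open scoped Matrix.Norms.Operator in
theorem continuous_exp_I_smul (H : Small n) :
    Continuous fun t : ℝ => NormedSpace.exp ((Complex.I * (t : ℂ)) • H) :=
  NormedSpace.exp_continuous.comp (by fun_prop)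

theorem smallPropagator_mem_unitary {H : Small n} (hH : H.IsHermitian) (t : ℝ) :
    smallPropagator B H t ∈ unitary (Composite n B) := by
  have h1 : NormedSpace.exp (-((Complex.I * (t : ℂ)) • H))
      = NormedSpace.exp ((Complex.I * ((-t : ℝ) : ℂ)) • H) := by
    congr 1; push_cast; rw [mul_neg, neg_smul]
  rw [Unitary.mem_iff, smallPropagator, star_tmul, star_exp_I_smul hH, star_one, tmul_mul_tmul,
    tmul_mul_tmul, one_mul, h1, ← exp_I_smul_add, ← exp_I_smul_add]
  simp [tmul_one_one]

variable [PartialOrder B] [StarOrderedRing B]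

/-- The matrix entry as a continuous linear map. -/
def entryCLM (i j : Fin n) : Composite n B →L[ℂ] B where
  toFun M := M i j
  map_add' _ _ := rfl
  map_smul' _ _ := rfl
  cont := continuous_entry i j

/-- The embedding `b ↦ 1 ⊗ b` as a continuous linear map. -/
def reservoirCLM (n : ℕ) (B : Type*) [CStarAlgebra B] [PartialOrder B] [StarOrderedRing B] :
    B →L[ℂ] Composite n B where
  toFun b := tmul 1 b
  map_add' := map_add (reservoirHom n B)
  map_smul' c b := map_smul (reservoirHom n B) c b
  cont := continuous_pi fun _ => continuous_pi fun _ => continuous_const.smul continuous_id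

theorem norm_tmul_one (hn : 0 < n) (b : B) : ‖(tmul 1 b : Composite n B)‖ = ‖b‖ :=
  NonUnitalStarAlgHom.norm_map (reservoirHom n B) (reservoirHom_injective hn) b

theorem hasDerivAt_tmul_one {f : ℝ → B} {d : B} {t : ℝ} (h : HasDerivAt f d t) :
    HasDerivAt (fun s => (tmul 1 (f s) : Composite n B)) (tmul 1 d) t :=
  ((reservoirCLM n B).restrictScalars ℝ).hasFDerivAt.comp_hasDerivAt t h

theorem hasDerivAt_of_tmul_one (hn : 0 < n) {f : ℝ → B} {D : Composite n B} {t : ℝ}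
    (h : HasDerivAt (fun s => (tmul 1 (f s) : Composite n B)) D t) :
    ∃ d : B, D = tmul 1 d ∧ HasDerivAt f d t := by
  have h1 := ((entryCLM ⟨0, hn⟩ ⟨0, hn⟩ : Composite n B →L[ℂ] B).restrictScalars
    ℝ).hasFDerivAt.comp_hasDerivAt t h
  have e : (fun s => (1 : Small n) ⟨0, hn⟩ ⟨0, hn⟩ • f s) = f := by
    funext s
    simp
  have h2 : HasDerivAt f (D ⟨0, hn⟩ ⟨0, hn⟩) t := e ▸ h1
  exact ⟨_, h.unique (hasDerivAt_tmul_one h2), h2⟩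

/-- The initial state as a continuous functional. -/
def initStateCLM {ω : B →ₗ[ℂ] ℂ} (hω : IsState ω) : Composite n B →L[ℂ] ℂ :=
  ∑ i : Fin n, ∑ j : Fin n, chaotic n (Matrix.single i j 1) • hω.toCLM.comp (entryCLM i j)

theorem initStateCLM_apply {ω : B →ₗ[ℂ] ℂ} (hω : IsState ω) (M : Composite n B) :
    initStateCLM hω M = initState ω M := by
  simp only [initStateCLM, initState, tensorFunctional, _root_.sum_apply]
  rfl

/-- The dynamics `id ⊗ τ` of the composite system. -/
def amplDyn (n : ℕ) (τ : CStarDynamics B) : CStarDynamics (Composite n B) where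
  aut t := mapAut (τ.aut t)
  aut_zero M := by ext; simp [τ.aut_zero]
  aut_add s t M := by ext; simp [τ.aut_add]
  tendsto_zero M := by
    rw [← tendsto_iff_norm_sub_tendsto_zero]
    refine tendsto_pi_nhds.2 fun i => tendsto_pi_nhds.2 fun j => ?_
    exact tendsto_iff_norm_sub_tendsto_zero.2 (τ.tendsto_zero (M i j))

theorem amplDyn_aut_tmul (τ : CStarDynamics B) (t : ℝ) (x : Small n) (b : B) :
    (amplDyn n τ).aut t (tmul x b) = tmul x (τ.aut t b) := mapAut_tmul _ _ _

/-- The uncoupled dynamics as the conjugation of `id ⊗ (α^L ∘ α^R)` by `e^{itH} ⊗ 1`. -/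
def freeCStarDyn {H : Small n} (hH : H.IsHermitian) (τ : CStarDynamics B) :
    CStarDynamics (Composite n B) :=
  (amplDyn n τ).cocycleConj (smallPropagator B H) (smallPropagator_mem_unitary hH)
    (continuous_tmul_const (continuous_exp_I_smul H) 1).continuousAt fun s t => by
      rw [smallPropagator, smallPropagator, smallPropagator, amplDyn_aut_tmul, map_one,
        tmul_mul_tmul, one_mul, exp_I_smul_add]

theorem freeCStarDyn_aut {H : Small n} (hH : H.IsHermitian) (τ : CStarDynamics B) (t : ℝ)
    (M : Composite n B) : (freeCStarDyn hH τ).aut t M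
      = smallPropagator B H t * (amplDyn n τ).aut t M * star (smallPropagator B H t) := rfl

theorem freeDyn_eq {H : Small n} (hH : H.IsHermitian) (αL αR : CStarDynamics B) (hc) :
    freeDyn H αL αR = fun t M => (freeCStarDyn hH (αL.comp αR hc)).aut t M := by
  funext t M
  rw [freeDyn, tensorMap, freeCStarDyn_aut, ← sum_tmul_single
    ((amplDyn n (αL.comp αR hc)).aut t M), Finset.mul_sum, Finset.sum_mul]
  refine Finset.sum_congr rfl fun i _ => ?_
  rw [Finset.mul_sum, Finset.sum_mul]
  refine Finset.sum_congr rfl fun j _ => ?_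
  rw [smallPropagator, star_tmul, star_one, tmul_mul_tmul, tmul_mul_tmul, one_mul, mul_one,
    star_exp_I_smul hH, mul_assoc]
  rfl

theorem freeCStarDyn_tmul_one {H : Small n} (hH : H.IsHermitian) (τ : CStarDynamics B) (t : ℝ)
    (b : B) : (freeCStarDyn hH τ).aut t (tmul 1 b) = tmul 1 (τ.aut t b) := by
  have h := Unitary.mul_star_self_of_mem (smallPropagator_mem_unitary (B := B) hH t)
  rw [smallPropagator, star_tmul, tmul_mul_tmul, star_one, one_mul] at h
  rw [freeCStarDyn_aut, amplDyn_aut_tmul, smallPropagator, star_tmul,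
    tmul_mul_tmul, tmul_mul_tmul, star_one, one_mul, mul_one, mul_one]
  have h2 : tmul (1 : Small n) (τ.aut t b) = 1 * tmul 1 (τ.aut t b) := (one_mul _).symm
  rw [h2, ← h, tmul_mul_tmul, one_mul, mul_one]

end Composite

/-! ### Scattering morphisms -/

section Scattering

variable {A : Type*} [CStarAlgebra A] {α σ : CStarDynamics A} {γ : A → A}

/-- The limit `γ = lim α_{-t} ∘ σ_t` of *-automorphisms is a *-homomorphism. -/
def scatteringHom (h : ∀ a : A, Tendsto (fun t : ℝ => α.aut (-t) (σ.aut t a)) atTop (𝓝 (γ a))) :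
    A →⋆ₐ[ℂ] A where
  toFun := γ
  map_one' := tendsto_nhds_unique (h 1) (by simp)
  map_mul' a b := tendsto_nhds_unique (h (a * b)) (by simpa using (h a).mul (h b))
  map_zero' := tendsto_nhds_unique (h 0) (by simp)
  map_add' a b := tendsto_nhds_unique (h (a + b)) (by simpa using (h a).add (h b))
  commutes' c := by
    rw [Algebra.algebraMap_eq_smul_one]
    exact tendsto_nhds_unique (h (c • 1)) (by simp)
  map_star' a := tendsto_nhds_unique (h (star a)) (by simpa [map_star] using (h a).star)

theorem norm_scattering
    (h : ∀ a : A, Tendsto (fun t : ℝ => α.aut (-t) (σ.aut t a)) atTop (𝓝 (γ a))) (a : A) :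
    ‖γ a‖ = ‖a‖ := by
  refine tendsto_nhds_unique (h a).norm ?_
  simp [α.norm_aut, σ.norm_aut]

theorem scattering_injective
    (h : ∀ a : A, Tendsto (fun t : ℝ => α.aut (-t) (σ.aut t a)) atTop (𝓝 (γ a))) :
    Function.Injective γ := by
  have h1 : Isometry (scatteringHom h) :=
    AddMonoidHomClass.isometry_of_norm (scatteringHom h) (norm_scattering h)
  exact h1.injective

/-- The intertwining relation `γ ∘ σ_s = α_s ∘ γ`. -/
theorem scattering_aut
    (h : ∀ a : A, Tendsto (fun t : ℝ => α.aut (-t) (σ.aut t a)) atTop (𝓝 (γ a))) (s : ℝ) (a : A) :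
    γ (σ.aut s a) = α.aut s (γ a) := by
  have h1 := (h a).comp (tendsto_atTop_add_const_right atTop s tendsto_id)
  have h2 := ((α.autCLM s).continuous.tendsto (γ a)).comp h1
  refine tendsto_nhds_unique (h (σ.aut s a)) (h2.congr fun t => ?_)
  change α.aut s (α.aut (-(t + s)) (σ.aut (t + s) a)) = _
  rw [← α.aut_add, σ.aut_add]
  congr 2
  ring

theorem hasDerivAt_scattering
    (h : ∀ a : A, Tendsto (fun t : ℝ => α.aut (-t) (σ.aut t a)) atTop (𝓝 (γ a))) {a d : A}
    (hd : HasDerivAt (fun t => σ.aut t a) d 0) :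
    HasDerivAt (fun t => α.aut t (γ a)) (γ d) 0 := by
  let g : A →ₗ[ℂ] A :=
    { toFun := γ
      map_add' := map_add (scatteringHom h)
      map_smul' := fun c a => map_smul (scatteringHom h) c a }
  have h1 := ((g.mkContinuous 1 fun a => by
    rw [one_mul]; exact (norm_scattering h a).le).restrictScalars ℝ).hasFDerivAt.comp_hasDerivAt
      (0 : ℝ) hd
  have e : (fun t => α.aut t (γ a)) = fun t => γ (σ.aut t a) :=
    funext fun t => (scattering_aut h t a).symm
  rw [e]
  exact h1

/-- Time averages over `[0, k + 1]` of a bounded continuous function converge to its limit. -/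
theorem tendsto_average {f : ℝ → ℂ} (hf : Continuous f) {C : ℝ} (hC : ∀ t, ‖f t‖ ≤ C) {l : ℂ}
    (hl : Tendsto f atTop (𝓝 l)) :
    Tendsto (fun k : ℕ => ((1 / ((k : ℝ) + 1) : ℝ) : ℂ) * ∫ t in (0 : ℝ)..((k : ℝ) + 1), f t)
      atTop (𝓝 l) := by
  have h1 : Tendsto (fun k : ℕ => ∫ u in (0 : ℝ)..1, f (((k : ℝ) + 1) * u)) atTop
      (𝓝 (∫ _ in (0 : ℝ)..1, l)) := by
    refine intervalIntegral.tendsto_integral_filter_of_dominated_convergence (fun _ => C)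
      (Eventually.of_forall fun k =>
        (hf.comp (continuous_const.mul continuous_id)).aestronglyMeasurable)
      (Eventually.of_forall fun k => Eventually.of_forall fun u _ => hC _)
      intervalIntegrable_const (Eventually.of_forall fun u hu => ?_)
    rw [Set.uIoc_of_le zero_le_one] at hu
    exact hl.comp ((tendsto_atTop_add_const_right _ _ tendsto_natCast_atTop_atTop).atTop_mul_const
      hu.1)
  rw [intervalIntegral.integral_const, sub_zero, one_smul] at h1
  refine h1.congr fun k => ?_
  rw [intervalIntegral.integral_comp_mul_left f (by positivity : (k : ℝ) + 1 ≠ 0), mul_zero,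
    mul_one, Complex.real_smul, one_div]

theorem isNESS_scattering
    (h : ∀ a : A, Tendsto (fun t : ℝ => α.aut (-t) (σ.aut t a)) atTop (𝓝 (γ a)))
    (ω : A →L[ℂ] ℂ) (hω : ∀ t a, ω (α.aut t a) = ω a) :
    IsNESS (fun t a => σ.aut t a) ω fun a => ω (γ a) := by
  refine ⟨fun k => (k : ℝ) + 1, fun i j hij => by simpa using hij,
    tendsto_atTop_add_const_right _ _ tendsto_natCast_atTop_atTop, fun a => ?_⟩
  refine tendsto_average (C := ‖ω‖ * ‖a‖) (ω.continuous.comp (σ.continuous_aut a))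
    (fun t => (ω.le_opNorm (σ.aut t a)).trans_eq (by rw [σ.norm_aut])) ?_
  exact ((ω.continuous.tendsto (γ a)).comp (h a)).congr fun t => hω (-t) (σ.aut t a)

end Scattering

/-! ### The bound on the extracted work -/

section Work

variable {n : ℕ} {B : Type*} [CStarAlgebra B] [PartialOrder B] [StarOrderedRing B]

/-- The work extracted by `U` from `ω ∘ γ` is the work extracted by `u` from the reservoirs, where
`γ(U) = 1 ⊗ u`: the intertwining relation turns the perturbed generator into the uncoupled one. -/
theorem exists_extractedWork_eq (hn : 0 < n) {H : Small n} (hH : H.IsHermitian)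
    {τ : CStarDynamics B} (ω : B →ₗ[ℂ] ℂ) {σ : CStarDynamics (Composite n B)}
    {γ : Composite n B → Composite n B}
    (hγ : ∀ a, Tendsto (fun t : ℝ => (freeCStarDyn hH τ).aut (-t) (σ.aut t a)) atTop (𝓝 (γ a)))
    (hran : Set.range γ = Set.range fun b : B => tmul (1 : Small n) b)
    {U : Composite n B} (hU : U ∈ unitary (Composite n B))
    (hdom : U ∈ genDomain fun t a => σ.aut t a) :
    ∃ u ∈ unitary B, γ U = tmul 1 u ∧ ∃ d : B, HasDerivAt (fun t => τ.aut t u) d 0 ∧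
      extractedWork (fun t a => σ.aut t a) (fun a => initState ω (γ a)) U
        = Complex.I * ω (star u * d) := by
  obtain ⟨u, hu : tmul 1 u = γ U⟩ : γ U ∈ Set.range fun b : B => tmul (1 : Small n) b :=
    hran ▸ Set.mem_range_self U
  have hγU : γ U ∈ unitary (Composite n B) := Unitary.map_mem (scatteringHom hγ) hU
  have hinj := reservoirHom_injective (B := B) hn
  have huU : u ∈ unitary B := by
    rw [← hu, Unitary.mem_iff, star_tmul, tmul_mul_tmul, tmul_mul_tmul, star_one, one_mul,
      ← tmul_one_one] at hγU
    exact Unitary.mem_iff.2 ⟨hinj hγU.1, hinj hγU.2⟩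
  have h1 := hasDerivAt_scattering hγ (a := U) (DifferentiableAt.hasDerivAt hdom)
  rw [← hu] at h1
  simp only [freeCStarDyn_tmul_one] at h1
  obtain ⟨d, hd, hd'⟩ := hasDerivAt_of_tmul_one hn h1
  refine ⟨u, huU, hu.symm, d, hd', ?_⟩
  have h2 : γ (star U * gen (fun t a => σ.aut t a) U) = tmul 1 (star u * d) := by
    refine (map_mul (scatteringHom hγ) _ _).trans ?_
    rw [map_star]
    refine (congrArg₂ (star · * ·) hu.symm hd).trans ?_
    rw [star_tmul, tmul_mul_tmul, star_one, one_mul]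
  rw [extractedWork, h2, initState_tmul_one hn]

/-- The generator of `id ⊗ τ` at `1 ⊗ u`. -/
theorem exists_gen_ampl_eq (hn : 0 < n) (τ : CStarDynamics B) {u : B}
    (h : (tmul 1 u : Composite n B) ∈ genDomain (ampl τ)) :
    ∃ d : B, gen (ampl τ) (tmul 1 u : Composite n B) = tmul 1 d ∧
      HasDerivAt (fun t => τ.aut t u) d 0 := by
  have h1 := DifferentiableAt.hasDerivAt h
  simp only [ampl_tmul_one] at h1
  obtain ⟨d, hd, hd'⟩ := hasDerivAt_of_tmul_one hn h1
  refine ⟨d, ?_, hd'⟩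
  rw [gen, ← hd]
  simp only [ampl_tmul_one]

/-- The bound for the reservoirs alone. The generator `δ_L + δ_R` of the uncoupled dynamics is
`2 / (β_L + β_R)` times `β_L δ_L + β_R δ_R`, for which the KMS state is passive, up to a multiple
of `δ_L - δ_R`. -/
theorem re_I_mul_le_of_KMS {αL αR : CStarDynamics B}
    (hcomm : ∀ (s t : ℝ) (b : B), αL.aut s (αR.aut t b) = αR.aut t (αL.aut s b))
    {βL βR : ℝ} (hβR : 0 < βR) (hβ : βR ≤ βL) {ω : B →ₗ[ℂ] ℂ} (hω : IsState ω)
    (hKMS : IsKMS 1 (fun t b => αL.aut (βL * t) (αR.aut (βR * t) b)) ω)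
    {u dL dR : B} (hu : u ∈ unitary B) (hL : HasDerivAt (fun t => αL.aut t u) dL 0)
    (hR : HasDerivAt (fun t => αR.aut t u) dR 0) :
    (Complex.I * ω (star u * (dL + dR))).re ≤ (βL - βR) / (βL + βR) * ‖dL - dR‖ := by
  have hp := CStarDynamics.hasDerivAt_comp (α := αL.rescale βL) (σ := αR.rescale βR)
    (fun s t b => hcomm _ _ b) (αL.hasDerivAt_rescale βL hL) (αR.hasDerivAt_rescale βR hR)
  have h1 := IsKMS.re_I_mul_nonpos _ hω one_pos hKMS hu hp
  have h2 : (ω (star u * dL) - ω (star u * dR)).im ≤ ‖dL - dR‖ := by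
    rw [← map_sub, ← mul_sub]
    refine (Complex.im_le_norm _).trans ((hω.norm_apply_le _).trans_eq ?_)
    exact CStarRing.norm_mem_unitary_mul _ (Unitary.star_mem hu)
  rw [mul_add, mul_smul_comm, mul_smul_comm, map_add, ← Complex.coe_smul, ← Complex.coe_smul,
    map_smul, map_smul] at h1
  rw [mul_add, map_add, div_mul_eq_mul_div, le_div_iff₀ (by linarith)]
  simp only [smul_eq_mul, Complex.mul_re, Complex.mul_im, Complex.add_re, Complex.add_im,
    Complex.I_re, Complex.I_im, Complex.ofReal_re, Complex.ofReal_im, Complex.sub_im] at h1 h2 ⊢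
  nlinarith [mul_le_mul_of_nonneg_left h2 (sub_nonneg.2 hβ)]

/-- The second law for the reservoirs at a common inverse temperature. Only the generator of
`α^L ∘ α^R` is involved, so that `u` need not be in the domains of the two generators. -/
theorem re_I_mul_nonpos_of_KMS {αL αR : CStarDynamics B}
    (hcomm : ∀ (s t : ℝ) (b : B), αL.aut s (αR.aut t b) = αR.aut t (αL.aut s b))
    {β : ℝ} (hβ : 0 < β) {ω : B →ₗ[ℂ] ℂ} (hω : IsState ω)
    (hKMS : IsKMS 1 (fun t b => αL.aut (β * t) (αR.aut (β * t) b)) ω)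
    {u d : B} (hu : u ∈ unitary B)
    (hd : HasDerivAt (fun t => (αL.comp αR hcomm).aut t u) d 0) :
    (Complex.I * ω (star u * d)).re ≤ 0 := by
  have h1 := IsKMS.re_I_mul_nonpos ((αL.comp αR hcomm).rescale β) hω one_pos hKMS hu
    ((αL.comp αR hcomm).hasDerivAt_rescale β hd)
  rw [mul_smul_comm, ← Complex.coe_smul, map_smul, smul_eq_mul, mul_left_comm,
    Complex.re_ofReal_mul] at h1
  exact nonpos_of_mul_nonpos_right h1 hβ

end Work

end NESS

end

theorem theorem3p3
    (n : ℕ) (hn : 0 < n)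
    {B : Type*} [CStarAlgebra B] [PartialOrder B] [StarOrderedRing B]
    -- the dynamics of the small system and of the two reservoirs
    (H : NESS.Small n) (hH : H.IsHermitian)
    (αL αR : NESS.CStarDynamics B)
    (hcomm : ∀ (s t : ℝ) (b : B), αL.aut s (αR.aut t b) = αR.aut t (αL.aut s b))
    -- the initial state of the reservoirs, at inverse temperatures `βL` and `βR`
    (βL βR : ℝ) (hβR : 0 < βR) (hβ : βR ≤ βL)
    (ωR : B →ₗ[ℂ] ℂ) (hωR : NESS.IsState ωR)
    (hKMS : NESS.IsKMS 1 (fun t b => αL.aut (βL * t) (αR.aut (βR * t) b)) ωR)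
    -- the coupling
    (V : NESS.Composite n B) (hV : IsSelfAdjoint V)
    -- the scattering morphism exists as a strong limit
    (γ : NESS.Composite n B → NESS.Composite n B)
    (hA1 : ∀ a : NESS.Composite n B,
      Tendsto (fun t : ℝ => NESS.freeDyn H αL αR (-t)
        (NESS.perturbed (NESS.freeDyn H αL αR) V t a)) atTop (𝓝 (γ a)))
    -- its range is `1 ⊗ B`
    (hA2 : Set.range γ = Set.range (fun b : B => NESS.tmul (1 : NESS.Small n) b)) :
    -- `γ⁻¹` is well defined on the range of `γ`
    Function.Injective γ ∧
    -- if the initial state is invariant under the uncoupled dynamics, `ω₊ = ω ∘ γ` is a NESS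
    ((∀ (t : ℝ) (a : NESS.Composite n B),
        NESS.initState ωR (NESS.freeDyn H αL αR t a) = NESS.initState ωR a) →
      NESS.IsNESS (NESS.perturbed (NESS.freeDyn H αL αR) V) (NESS.initState ωR)
        (fun a => NESS.initState ωR (γ a))) ∧
    -- the bound on the extracted work, which vanishes when the temperatures approach each other
    (∀ U ∈ unitary (NESS.Composite n B),
      U ∈ NESS.genDomain (NESS.perturbed (NESS.freeDyn H αL αR) V) →
      γ U ∈ NESS.genDomain (NESS.ampl αL) → γ U ∈ NESS.genDomain (NESS.ampl αR) →
      NESS.diffGen αL αR (γ U) ∈ Set.range γ ∧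
      (NESS.extractedWork (NESS.perturbed (NESS.freeDyn H αL αR) V)
        (fun a => NESS.initState ωR (γ a)) U).im = 0 ∧
      (NESS.extractedWork (NESS.perturbed (NESS.freeDyn H αL αR) V)
        (fun a => NESS.initState ωR (γ a)) U).re
        ≤ (βL - βR) / (βL + βR) * ‖Function.invFun γ (NESS.diffGen αL αR (γ U))‖ ∧
      Tendsto (fun b : ℝ => (b - βR) / (b + βR) *
        ‖Function.invFun γ (NESS.diffGen αL αR (γ U))‖) (𝓝 βR) (𝓝 0)) ∧
    -- the second law at equal temperatures
    (βL = βR → ∀ U ∈ unitary (NESS.Composite n B),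
      U ∈ NESS.genDomain (NESS.perturbed (NESS.freeDyn H αL αR) V) →
      (NESS.extractedWork (NESS.perturbed (NESS.freeDyn H αL αR) V)
        (fun a => NESS.initState ωR (γ a)) U).im = 0 ∧
      (NESS.extractedWork (NESS.perturbed (NESS.freeDyn H αL αR) V)
        (fun a => NESS.initState ωR (γ a)) U).re ≤ 0) := by
  have hfree := NESS.freeDyn_eq hH αL αR hcomm
  have hpert : NESS.perturbed (NESS.freeDyn H αL αR) V
      = fun t a => ((NESS.freeCStarDyn hH (αL.comp αR hcomm)).perturb V hV).aut t a := by
    funext t a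
    rw [hfree, NESS.CStarDynamics.perturbed_eq]
  rw [hpert] at hA1 ⊢
  rw [hfree] at hA1 ⊢
  have hinit : NESS.initState ωR = ⇑(NESS.initStateCLM (n := n) hωR) :=
    funext fun a => (NESS.initStateCLM_apply hωR a).symm
  refine ⟨NESS.scattering_injective hA1, fun hinv => ?_, fun U hU hdom hL hR => ?_,
    fun hβeq U hU hdom => ?_⟩
  · rw [hinit] at hinv ⊢
    exact NESS.isNESS_scattering hA1 _ hinv
  · obtain ⟨u, hu, hγu, d, hd, hwork⟩ :=
      NESS.exists_extractedWork_eq hn hH ωR hA1 hA2 hU hdom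
    rw [hγu] at hL hR
    obtain ⟨dL, hgL, hdL⟩ := NESS.exists_gen_ampl_eq hn αL hL
    obtain ⟨dR, hgR, hdR⟩ := NESS.exists_gen_ampl_eq hn αR hR
    have hdiff : NESS.diffGen αL αR (γ U) = NESS.tmul 1 (dL - dR) := by
      rw [NESS.diffGen, hγu, hgL, hgR]
      exact (map_sub (NESS.reservoirHom n B) dL dR).symm
    have hmem : NESS.diffGen αL αR (γ U) ∈ Set.range γ := by
      rw [hA2, hdiff]
      exact Set.mem_range_self _
    have hnorm : ‖Function.invFun γ (NESS.diffGen αL αR (γ U))‖ = ‖dL - dR‖ := by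
      rw [← NESS.norm_scattering hA1, Function.invFun_eq hmem, hdiff, NESS.norm_tmul_one hn]
    obtain rfl : d = dL + dR := hd.unique (NESS.CStarDynamics.hasDerivAt_comp hcomm hdL hdR)
    refine ⟨hmem, ?_, ?_, ?_⟩
    · rw [hwork]
      exact hωR.im_I_mul_eq_zero _ hu hd
    · rw [hwork, hnorm]
      exact NESS.re_I_mul_le_of_KMS hcomm hβR hβ hωR hKMS hu hdL hdR
    · have hc : ContinuousAt (fun b : ℝ => (b - βR) / (b + βR) *
          ‖Function.invFun γ (NESS.diffGen αL αR (γ U))‖) βR :=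
        ((continuousAt_id.sub continuousAt_const).div (continuousAt_id.add continuousAt_const)
          (by simpa using hβR.ne')).mul continuousAt_const
      simpa [ContinuousAt] using hc.tendsto
  · obtain ⟨u, hu, -, d, hd, hwork⟩ := NESS.exists_extractedWork_eq hn hH ωR hA1 hA2 hU hdom
    subst hβeq
    rw [hwork]
    exact ⟨hωR.im_I_mul_eq_zero _ hu hd, NESS.re_I_mul_nonpos_of_KMS hcomm hβR hωR hKMS hu hd⟩
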